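/- Let $E$ be a Lusin topological space (homeomorphic to a Borel subset of a compact metric space) with Borel $\sigma$-algebra $\mathcal B(E)$, and let $X=(\Omega,\mathcal F,\mathcal F_t,X_t,\theta_t,P^x)$ be a Borel right process with state space $E$ and lifetime $\zeta$: a normal, right continuous, time-homogeneous Markov process with values in $E$ up to $\zeta$ and at an isolated absorbing cemetery point $\Delta$ from then on (functions on $E$ are extended by $0$ at $\Delta$), whose transition function $p_tf(x)=E^x[f(X_t);t<\zeta]$ consists of kernels on $(E,\mathcal B(E))$, whose filtration $(\mathcal F_t)$ is right continuous and augmented, and such that for every $\beta>0$ and every $u\in\mathcal E(\mathcal U_\beta)$ the map $t\mapsto u(X_t)$ is a.s. right continuous on $[0,\infty)$. Here $U_\alpha f(x)=E^x\int_0^\infty e^{-\alpha t}f(X_t)\,dt$, and $\mathcal E(\mathcal U_\beta)$ is the set of Borel functions $u:E\to[0,\infty]$ with $\alpha U_{\beta+\alpha}u\le u$ for all $\alpha>0$ and $\lim_{\alpha\to\infty}\alpha U_{\beta+\alpha}u=u$ pointwise. Let $[b\mathcal E(\mathcal U_\beta)]$ be the linear span of the bounded elements of $\mathcal E(\mathcal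 U_\beta)$; more generally $[\mathcal G]$ is the linear span of $\mathcal G$ and $\overline{\mathcal G}$ its closure in the supremum norm. For a finite measure $\mu$ on $E$ put $P^\mu=\int P^x\,\mu(dx)$. Assume that $X$ has càdlàg trajectories: for every finite measure $\mu$ on $E$, $P^\mu$-a.s. the left limits $X_{t-}$ exist in $E$ for all $t\in(0,\zeta)$. (1) Let $\beta>0$, let $\mathcal F_0$ be a countable subset of $[b\mathcal E(\mathcal U_\beta)]$ generating the topology of $E$, and let $\mathcal K\subset\overline{[\mathcal F_0]}$ be multiplicative ($f,g\in\mathcal K\Rightarrow fg\in\mathcal K$) and separate the points of $E$. If $p_tf\in\overline{[\mathcal F_0]}$ for all $f\in\mathcal K$ and $t>0$, then $X$ is quasi-left continuous up to $\zeta$: for every finite measure $\mu$ on $E$ and all $(\mathcal F_t)$-stopping times $T_n\nearrow T$, $X_{T_n}\to X_T$ $P^\mu$-a.e. on $[T<\zeta]$. Hence $X$ is standard, i.e. a right process with càdlàg trajectories that is quasi-left continuous up to $\zeta$. (2) If $(p_t)_{t\ge0}$ is Markovian ($p_t1=1$ for all $t$), the same conclusion holds whenever $\mathcal K$ is a multiplicative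 family of bounded continuous real-valued functions on $E$ that separates the points of $E$ and $p_tf$ is continuous for all $f\in\mathcal K$ and $t>0$. -/

import Mathlib

open MeasureTheory Filter Set Topology
open scoped NNReal ENNReal

/-- A Lusin topological space: a space homeomorphic to a Borel subset of a compact metric space. -/
def IsLusinSpace.{u} (E : Type u) [TopologicalSpace E] : Prop :=
  ∃ (K : Type u) (_ : MetricSpace K) (_ : CompactSpace K) (B : Set K),
    MeasurableSet[borel K] B ∧ Nonempty (E ≃ₜ B)

/-- The state space `E` with a cemetery point adjoined as an isolated point. -/
abbrev WithCemetery (E : Type*) : Type _ := E ⊕ Unit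

/-- The cemetery point. -/
abbrev cemetery {E : Type*} : WithCemetery E := Sum.inr ()

/-- Extension of a numerical function on `E` by `0` at the cemetery. -/
def extendZero {E R : Type*} [Zero R] (f : E → R) : WithCemetery E → R :=
  Sum.elim f (fun _ => 0)

/-- A time-homogeneous, normal, right-continuous Markov process
`(Ω, 𝓕, 𝓕_t, X_t, θ_t, P^x)` with state space `E`, lifetime, and Borel transition function. -/
structure BorelMarkovProcess (E Ω : Type*) [TopologicalSpace E] [MeasurableSpace E]
    [mΩ : MeasurableSpace Ω] where
  /-- the filtration `(𝓕_t)` -/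
  ℱ : Filtration ℝ≥0 mΩ
  /-- the process; it takes values in `E` before its lifetime and is at the cemetery afterwards -/
  X : ℝ≥0 → Ω → WithCemetery E
  /-- the shift operators -/
  θ : ℝ≥0 → Ω → Ω
  /-- the laws `P^x` -/
  P : WithCemetery E → Measure Ω
  isProbabilityMeasure : ∀ x, IsProbabilityMeasure (P x)
  adapted : ∀ t, Measurable[ℱ t] (X t)
  absorbing : ∀ ω s t, s ≤ t → X s ω = cemetery → X t ω = cemetery
  rightContinuous : ∀ ω t, ContinuousWithinAt (fun s => X s ω) (Ici t) t
  shift : ∀ s t ω, X s (θ t ω) = X (t + s) ω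
  normal : ∀ x, ∀ᵐ ω ∂(P x), X 0 ω = x
  /-- `x ↦ P^x(A)` is universally measurable for every event `A` -/
  universallyMeasurable : ∀ A : Set Ω, MeasurableSet A →
    ∀ μ : Measure (WithCemetery E), IsFiniteMeasure μ → AEMeasurable (fun x => P x A) μ
  /-- the transition function consists of kernels on the Borel `σ`-algebra -/
  borel_transition : ∀ t, ∀ A : Set (WithCemetery E), MeasurableSet A →
    Measurable (fun x => P x (X t ⁻¹' A))
  markov : ∀ x s t, ∀ B : Set Ω, MeasurableSet[ℱ t] B →
    ∀ A : Set (WithCemetery E), MeasurableSet A →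
      P x (B ∩ X (t + s) ⁻¹' A) = ∫⁻ ω in B, P (X t ω) (X s ⁻¹' A) ∂(P x)

namespace BorelMarkovProcess

variable {E Ω : Type*} [TopologicalSpace E] [MeasurableSpace E] [MeasurableSpace Ω]

/-- The measure `P^μ(A) = ∫ P^x(A) μ(dx)`. -/
noncomputable def law (X : BorelMarkovProcess E Ω) (μ : Measure (WithCemetery E))
    [hμ : IsFiniteMeasure μ] : Measure Ω :=
  Measure.ofMeasurable (fun A _ => ∫⁻ x, X.P x A ∂μ) (by simp) (by
    intro f hf hd
    rw [← lintegral_tsum (fun i => X.universallyMeasurable (f i) (hf i) μ hμ)]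
    exact lintegral_congr (fun x => measure_iUnion hd hf))

theorem law_apply (X : BorelMarkovProcess E Ω) (μ : Measure (WithCemetery E))
    [IsFiniteMeasure μ] {A : Set Ω} (hA : MeasurableSet A) :
    X.law μ A = ∫⁻ x, X.P x A ∂μ :=
  Measure.ofMeasurable_apply A hA

/-- The lifetime `ζ`. -/
noncomputable def lifetime (X : BorelMarkovProcess E Ω) (ω : Ω) : WithTop ℝ≥0 :=
  sInf ((fun t : ℝ≥0 => (t : WithTop ℝ≥0)) '' {t | X.X t ω = cemetery})

/-- `p_t f (x) = E^x[f(X_t); t < ζ]`, for bounded Borel real-valued `f`. -/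
noncomputable def transition (X : BorelMarkovProcess E Ω) (t : ℝ≥0) (f : E → ℝ) (x : E) : ℝ :=
  ∫ ω, extendZero f (X.X t ω) ∂(X.P (Sum.inl x))

/-- The transition function is Markovian: `p_t 1 = 1`. -/
def IsMarkovian (X : BorelMarkovProcess E Ω) : Prop :=
  ∀ t, ∀ x : E, X.P (Sum.inl x) {ω | X.X t ω ∈ range Sum.inl} = 1

/-- The resolvent of the process, `U_α f (x) = E^x ∫_0^∞ e^{-α t} f(X_t) dt`,
for Borel `f : E → [0, ∞]`. -/
noncomputable def resolvent (X : BorelMarkovProcess E Ω) (α : ℝ) (f : E → ℝ≥0∞) (x : E) :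
    ℝ≥0∞ :=
  ∫⁻ ω, (∫⁻ t in Ici (0 : ℝ),
    ENNReal.ofReal (Real.exp (-α * t)) * extendZero f (X.X t.toNNReal ω)) ∂(X.P (Sum.inl x))

/-- `u` is a Borel `𝓤_β`-excessive function, where `𝓤_β = (U_{β+α})_{α>0}`. -/
structure IsExcessive (X : BorelMarkovProcess E Ω) (β : ℝ) (u : E → ℝ≥0∞) : Prop where
  measurable : Measurable u
  supermedian : ∀ α : ℝ, 0 < α → ∀ x, ENNReal.ofReal α * X.resolvent (β + α) u x ≤ u x
  tendsto : ∀ x, Tendsto (fun α : ℝ => ENNReal.ofReal α * X.resolvent (β + α) u x) atTop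
    (𝓝 (u x))

/-- The linear space `[b𝓔(𝓤_β)]` spanned by the bounded `𝓤_β`-excessive functions. -/
noncomputable def boundedExcessiveSpan (X : BorelMarkovProcess E Ω) (β : ℝ) :
    Submodule ℝ (E → ℝ) :=
  Submodule.span ℝ {f | (∀ x, 0 ≤ f x) ∧ (∃ C : ℝ, ∀ x, f x ≤ C) ∧
    X.IsExcessive β (fun x => ENNReal.ofReal (f x))}

/-- A (Borel) right process: the filtration satisfies the usual hypotheses (it is right
continuous and augmented with respect to all the laws `P^μ`), and `t ↦ u(X_t)` is a.s. right
continuous for every excessive function `u` of the resolvents `𝓤_β`, `β > 0`. -/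
structure IsRight (X : BorelMarkovProcess E Ω) : Prop where
  filtration_rightContinuous : ∀ t, (⨅ s > t, (X.ℱ s : MeasurableSpace Ω)) ≤ X.ℱ t
  filtration_augmented : ∀ t, ∀ A : Set Ω,
    (∀ μ : Measure (WithCemetery E), ∀ _ : IsFiniteMeasure μ,
      ∃ B : Set Ω, MeasurableSet[X.ℱ t] B ∧ X.law μ (symmDiff A B) = 0) →
    MeasurableSet[X.ℱ t] A
  excessive_rightContinuous : ∀ β : ℝ, 0 < β → ∀ u : E → ℝ≥0∞, X.IsExcessive β u →
    ∀ μ : Measure (WithCemetery E), ∀ _ : IsFiniteMeasure μ,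
      ∀ᵐ ω ∂(X.law μ), ∀ t,
        ContinuousWithinAt (fun s => extendZero u (X.X s ω)) (Ici t) t

/-- Càdlàg trajectories: for every finite measure `μ` on `E`, `P^μ`-a.s. the left limits of the
(right continuous) paths exist in `E` on `(0, ζ)`. -/
def HasCadlagPaths (X : BorelMarkovProcess E Ω) : Prop :=
  ∀ μ : Measure E, ∀ _ : IsFiniteMeasure μ, ∀ᵐ ω ∂(X.law (μ.map Sum.inl)),
    ∀ t : ℝ≥0, 0 < t → (t : WithTop ℝ≥0) < X.lifetime ω →
      ∃ y : E, Tendsto (fun s => X.X s ω) (𝓝[<] t) (𝓝 (Sum.inl y))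

/-- Quasi-left continuity up to `ζ`: for every finite measure `μ` on `E` and all stopping times
`T_n ↗ T`, `X_{T_n} → X_T` `P^μ`-a.e. on `[T < ζ]`. -/
def IsQuasiLeftContinuous (X : BorelMarkovProcess E Ω) : Prop :=
  ∀ μ : Measure E, ∀ _ : IsFiniteMeasure μ,
    ∀ (τ : ℕ → Ω → WithTop ℝ≥0) (T : Ω → WithTop ℝ≥0),
      (∀ n, IsStoppingTime X.ℱ (τ n)) → (∀ ω, Monotone (fun n => τ n ω)) →
      (∀ ω, T ω = ⨆ n, τ n ω) →
      ∀ᵐ ω ∂(X.law (μ.map Sum.inl)), T ω < X.lifetime ω →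
        Tendsto (fun n => stoppedValue X.X (τ n) ω) atTop (𝓝 (stoppedValue X.X T ω))

/-- A standard process: a right process with càdlàg trajectories which is quasi-left continuous
up to its lifetime. -/
structure IsStandard (X : BorelMarkovProcess E Ω) : Prop where
  right : X.IsRight
  cadlag : X.HasCadlagPaths
  quasiLeftContinuous : X.IsQuasiLeftContinuous

end BorelMarkovProcess

/-- The closure of a set of real-valued functions in the supremum norm. -/
def supNormClosure {E : Type*} (G : Set (E → ℝ)) : Set (E → ℝ) :=
  {f | ∀ ε : ℝ, 0 < ε → ∃ g ∈ G, ∀ x, |f x - g x| ≤ ε}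

/-- The family `G` generates the topology of `E`: it is the coarsest topology that makes every
element of `G` continuous. -/
def GeneratesTopology {E : Type*} [t : TopologicalSpace E] (G : Set (E → ℝ)) : Prop :=
  t = ⨅ f ∈ G, TopologicalSpace.induced f inferInstance

/-- The family `K` is stable under products. -/
def IsMultiplicative {E : Type*} (K : Set (E → ℝ)) : Prop :=
  ∀ f ∈ K, ∀ g ∈ K, f * g ∈ K

/-! Both parts reduce to one statement: if the functions of a multiplicative, point-separating
family `K` are bounded and continuous, and so is `p_t f` for `f ∈ K`, `t > 0`, then the process is
quasi-left continuous up to `ζ`. In (1), elements of the closed span are continuous because the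
generating family is, and bounded because excessive generators are.

Truncate the times to make them finite, and suppose `X_{T_n} → y ∈ E`. The strong Markov property
gives `E[f(X_{T_n+t}) | F_{T_n}] = p_t f(X_{T_n})`. As `n → ∞` and then `t → 0`, the right side
tends to `p_t f(y)` and then to `f(y)`. On the left, `T_n + t` passes `T`, so right continuity and a
Hunt-type limit lemma (`ae_eq_condExp_iSup_of_iterated_tendsto`) lead to `E[f(X_T) | 𝒢]`, where `𝒢 =
⋁ F_{T_n}`. Hence `f(y) = E[f(X_T) | 𝒢]`.

The same holds for `f²`, so the conditional variance of `f(X_T)` vanishes where the limit exists,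
and `f(X_T) = f(y)` there (`ae_eq_condExp_of_condExp_sq_eq`). A countable separating subfamily of
`K` then gives `X_T = y` almost surely. -/

/-! ### Limits of conditional expectations and conditional variance. -/

section ConditionalExpectation

variable {Ω : Type*} {m0 : MeasurableSpace Ω} {P : Measure Ω} [IsFiniteMeasure P]

/-- An iterated-limit form of Hunt's lemma: `L¹` contraction and two applications of Fatou compare
`E[Z k n | 𝒢 n]` with `E[Y | 𝒢 n]`, and Lévy's upward theorem handles the latter. The limits `a`,
`b` are quantified inside the almost-sure statement because convergence is available only on part of
`Ω`. -/
theorem ae_eq_condExp_iSup_of_iterated_tendsto (𝒢 : Filtration ℕ m0) {Y : Ω → ℝ}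
    {Z : ℕ → ℕ → Ω → ℝ} {C : ℝ} (hYm : Measurable Y) (hYC : ∀ ω, |Y ω| ≤ C)
    (hZm : ∀ k n, Measurable (Z k n)) (hZC : ∀ k n ω, |Z k n ω| ≤ C)
    (hlim : ∀ᵐ ω ∂P, ∀ ε : ℝ, 0 < ε → ∀ᶠ k in atTop, ∀ᶠ n in atTop, |Z k n ω - Y ω| ≤ ε) :
    ∀ᵐ ω ∂P, ∀ (a : ℕ → ℝ) (b : ℝ),
      (∀ k, Tendsto (fun n => (P[Z k n | 𝒢 n]) ω) atTop (𝓝 (a k))) →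
      Tendsto a atTop (𝓝 b) → b = (P[Y | ⨆ n, 𝒢 n]) ω := by
  have hYi : Integrable Y P := .of_bound hYm.aestronglyMeasurable C (.of_forall hYC)
  have hZi : ∀ k n, Integrable (Z k n) P := fun k n =>
    .of_bound (hZm k n).aestronglyMeasurable C (.of_forall (hZC k n))
  set D : ℕ → ℕ → Ω → ℝ≥0∞ := fun k n ω => ‖(P[Z k n | 𝒢 n]) ω - (P[Y | 𝒢 n]) ω‖ₑ with hD
  set W : ℕ → Ω → ℝ≥0∞ := fun k ω => limsup (fun n => ‖Z k n ω - Y ω‖ₑ) atTop with hW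
  have hDm : ∀ k n, Measurable (D k n) := fun k n =>
    (((stronglyMeasurable_condExp.mono (𝒢.le n)).sub
      (stronglyMeasurable_condExp.mono (𝒢.le n))).measurable).enorm
  have hbd : ∀ k n ω, ‖Z k n ω - Y ω‖ₑ ≤ ENNReal.ofReal (C + C) := fun k n ω => by
    rw [Real.enorm_eq_ofReal_abs]
    exact ENNReal.ofReal_le_ofReal
      ((abs_sub _ _).trans (add_le_add (hZC k n ω) (hYC ω)))
  have hDle : ∀ k n, ∫⁻ ω, D k n ω ∂P ≤ ∫⁻ ω, ‖Z k n ω - Y ω‖ₑ ∂P := fun k n => by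
    have h1 := eLpNorm_condExp_le_eLpNorm (m := 𝒢 n) (μ := P) (Z k n - Y) le_rfl
    rw [eLpNorm_congr_ae (condExp_sub (hZi k n) hYi (𝒢 n))] at h1
    simpa [eLpNorm_one_eq_lintegral_enorm] using h1
  have hfin : ∫⁻ _, ENNReal.ofReal (C + C) ∂P ≠ ∞ := by
    rw [lintegral_const]
    exact ENNReal.mul_ne_top ENNReal.ofReal_ne_top (measure_ne_top _ _)
  have hWm : ∀ k, Measurable (W k) := fun k =>
    Measurable.limsup (fun n => ((hZm k n).sub hYm).enorm)
  have hDW : ∀ k, ∫⁻ ω, liminf (fun n => D k n ω) atTop ∂P ≤ ∫⁻ ω, W k ω ∂P := fun k =>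
    calc ∫⁻ ω, liminf (fun n => D k n ω) atTop ∂P
        ≤ liminf (fun n => ∫⁻ ω, D k n ω ∂P) atTop := lintegral_liminf_le (hDm k)
      _ ≤ liminf (fun n => ∫⁻ ω, ‖Z k n ω - Y ω‖ₑ ∂P) atTop :=
          liminf_le_liminf (.of_forall (hDle k))
      _ ≤ limsup (fun n => ∫⁻ ω, ‖Z k n ω - Y ω‖ₑ ∂P) atTop := liminf_le_limsup
      _ ≤ ∫⁻ ω, W k ω ∂P := limsup_lintegral_le (fun _ => ENNReal.ofReal (C + C))
          (fun n => ((hZm k n).sub hYm).enorm) (fun n => .of_forall (hbd k n)) hfin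
  have hW0 : Tendsto (fun k => ∫⁻ ω, W k ω ∂P) atTop (𝓝 0) := by
    have := tendsto_lintegral_of_dominated_convergence (μ := P) (F := W) (f := fun _ => 0)
      (fun _ => ENNReal.ofReal (C + C)) hWm
      (fun k => .of_forall fun ω => limsup_le_of_le (h := .of_forall fun n => hbd k n ω)) hfin ?_
    · simpa using this
    · filter_upwards [hlim] with ω hω
      rw [ENNReal.tendsto_nhds_zero]
      intro ε hε
      obtain ⟨δ, hδ0, hδ⟩ := ENNReal.lt_iff_exists_nnreal_btwn.1 hε
      filter_upwards [hω δ (by exact_mod_cast hδ0)] with k hk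
      refine limsup_le_of_le (h := ?_)
      filter_upwards [hk] with n hn
      rw [Real.enorm_eq_ofReal_abs]
      refine (ENNReal.ofReal_le_ofReal hn).trans ?_
      rw [ENNReal.ofReal_coe_nnreal]
      exact hδ.le
  have hLm : ∀ k, Measurable fun ω => liminf (fun n => D k n ω) atTop := fun k =>
    Measurable.liminf (hDm k)
  have hzero : ∫⁻ ω, liminf (fun k => liminf (fun n => D k n ω) atTop) atTop ∂P = 0 := by
    refine le_antisymm ?_ zero_le
    calc _ ≤ liminf (fun k => ∫⁻ ω, liminf (fun n => D k n ω) atTop ∂P) atTop :=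
          lintegral_liminf_le hLm
      _ ≤ liminf (fun k => ∫⁻ ω, W k ω ∂P) atTop := liminf_le_liminf (.of_forall hDW)
      _ = 0 := hW0.liminf_eq
  rw [lintegral_eq_zero_iff (Measurable.liminf hLm)] at hzero
  filter_upwards [hzero, tendsto_ae_condExp (ℱ := 𝒢) (μ := P) Y] with ω h0 hV a b ha hb
  -- At an `ω` where the limits exist, the lower limits are genuine limits, so their vanishing
  -- identifies `b`.
  have h1 : ∀ k, liminf (fun n => D k n ω) atTop = ‖a k - (P[Y | ⨆ n, 𝒢 n]) ω‖ₑ := fun k =>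
    (((ha k).sub hV).enorm).liminf_eq
  simp only [h1] at h0
  rw [((hb.sub_const _).enorm).liminf_eq] at h0
  simpa [sub_eq_zero] using h0

/-- The set where the conditional variance vanishes is `m`-measurable, so the integral of `(Y - E[Y
| m])²` over it is zero. -/
theorem ae_eq_condExp_of_condExp_sq_eq {m : MeasurableSpace Ω} (hm : m ≤ m0) {Y : Ω → ℝ}
    (hY : MemLp Y 2 P) :
    ∀ᵐ ω ∂P, (P[Y ^ 2 | m]) ω = (P[Y | m]) ω ^ 2 → Y ω = (P[Y | m]) ω := by
  set s : Set Ω := {ω | (P[Y ^ 2 | m]) ω = (P[Y | m]) ω ^ 2} with hs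
  have hsm : MeasurableSet[m] s :=
    measurableSet_eq_fun stronglyMeasurable_condExp.measurable
      (stronglyMeasurable_condExp.measurable.pow_const 2)
  have hi : Integrable ((Y - P[Y | m]) ^ 2) P := (hY.sub (hY.condExp one_le_two)).integrable_sq
  have h := ProbabilityTheory.setIntegral_condVar (hm := hm) hi hsm
  have h0 : ∫ ω in s, (ProbabilityTheory.condVar m Y P) ω ∂P = 0 := by
    rw [setIntegral_congr_ae (g := fun _ => 0) (hm s hsm)]
    · simp
    · filter_upwards [ProbabilityTheory.condVar_ae_eq_condExp_sq_sub_sq_condExp hm hY] with ω h1 h2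
      rw [h1, Pi.sub_apply, Pi.pow_apply, h2, sub_self]
  rw [h0, eq_comm, setIntegral_eq_zero_iff_of_nonneg_ae
    (f := fun ω => (Y ω - (P[Y | m]) ω) ^ 2) (.of_forall fun ω => sq_nonneg _)
    hi.integrableOn] at h
  rw [EventuallyEq, ae_restrict_iff' (hm s hsm)] at h
  filter_upwards [h] with ω h1 h2
  have := h1 h2
  simpa [sub_eq_zero] using this

end ConditionalExpectation

/-! ### Functions extended by zero at the cemetery. -/

section ExtendZero

variable {E : Type*}

@[simp] theorem extendZero_inl {R : Type*} [Zero R] (f : E → R) (x : E) :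
    extendZero f (Sum.inl x) = f x := rfl

@[simp] theorem extendZero_inr {R : Type*} [Zero R] (f : E → R) (u : Unit) :
    extendZero f (Sum.inr u) = 0 := rfl

theorem abs_extendZero_le {f : E → ℝ} {C : ℝ} (hC0 : 0 ≤ C) (hC : ∀ x, |f x| ≤ C)
    (z : WithCemetery E) : |extendZero f z| ≤ C := by
  rcases z with x | u
  · exact hC x
  · simpa using hC0

theorem extendZero_mul (f g : E → ℝ) (z : WithCemetery E) :
    extendZero (f * g) z = extendZero f z * extendZero g z := by
  rcases z with x | u <;> simp

theorem measurable_extendZero [MeasurableSpace E] {f : E → ℝ} (hf : Measurable f) :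
    Measurable (extendZero f) :=
  hf.sumElim measurable_const

theorem continuous_extendZero [TopologicalSpace E] {f : E → ℝ} (hf : Continuous f) :
    Continuous (extendZero f) :=
  hf.sumElim continuous_const

end ExtendZero

/-! ### Approximation of times from the right by a grid. -/

section GridApproximation

/-- The index of the cell of the grid `(k + 1)⁻¹ ℕ` that contains `r`. -/
noncomputable def gridIndex (k : ℕ) (r : ℝ≥0) : ℕ := ⌊((k : ℝ≥0) + 1) * r⌋₊

/-- The right end point of the `j`-th cell of the grid `(k + 1)⁻¹ ℕ`. -/
noncomputable def gridPoint (k j : ℕ) : ℝ≥0 := ((j : ℝ≥0) + 1) / ((k : ℝ≥0) + 1)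

/-- The smallest element of `(k + 1)⁻¹ ℕ` strictly above `r`. -/
noncomputable def gridAbove (k : ℕ) (r : ℝ≥0) : ℝ≥0 := gridPoint k (gridIndex k r)

theorem measurable_eval_countable_index {Ω β : Type*} [MeasurableSpace Ω] [MeasurableSpace β]
    {v : ℕ → Ω → β} (hv : ∀ j, Measurable (v j)) {N : Ω → ℕ} (hN : Measurable N) :
    Measurable fun ω => v (N ω) ω := by
  have h : Measurable fun q : ℕ × Ω => v q.1 q.2 := measurable_from_prod_countable_right hv
  exact h.comp (hN.prodMk measurable_id)

theorem measurable_gridIndex (k : ℕ) : Measurable (gridIndex k) :=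
  Nat.measurable_floor.comp (measurable_const.mul measurable_id)

theorem lt_gridAbove (k : ℕ) (r : ℝ≥0) : r < gridAbove k r := by
  rw [gridAbove, gridPoint, gridIndex, lt_div_iff₀ (by positivity), mul_comm]
  exact Nat.lt_floor_add_one _

theorem gridAbove_le (k : ℕ) (r : ℝ≥0) : gridAbove k r ≤ r + 1 / ((k : ℝ≥0) + 1) := by
  have h : (0 : ℝ≥0) < (k : ℝ≥0) + 1 := by positivity
  have h1 : (r + 1 / ((k : ℝ≥0) + 1)) * ((k : ℝ≥0) + 1) = ((k : ℝ≥0) + 1) * r + 1 := by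
    field_simp
  rw [gridAbove, gridPoint, gridIndex, div_le_iff₀ h, h1]
  gcongr
  exact Nat.floor_le zero_le

theorem tendsto_gridAbove (r : ℝ≥0) : Tendsto (fun k => gridAbove k r) atTop (𝓝 r) := by
  have h : Tendsto (fun k : ℕ => r + 1 / ((k : ℝ≥0) + 1)) atTop (𝓝 (r + 0)) :=
    tendsto_const_nhds.add tendsto_one_div_add_atTop_nhds_zero_nat
  rw [add_zero] at h
  exact tendsto_of_tendsto_of_tendsto_of_le_of_le tendsto_const_nhds h
    (fun k => (lt_gridAbove k r).le) (fun k => gridAbove_le k r)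

/-- On `[0, i]` the process is a limit of processes constant in time on grid cells. Capping the grid
points at `i` keeps these `f i`-measurable and still approaches each `s ≤ i` from the right. -/
theorem isStronglyProgressive_of_rightContinuous {Ω : Type*} {m : MeasurableSpace Ω}
    {f : Filtration ℝ≥0 m} {u : ℝ≥0 → Ω → ℝ} (hu : ∀ t, Measurable[f t] (u t))
    (hc : ∀ ω t, ContinuousWithinAt (fun s => u s ω) (Ici t) t) :
    IsStronglyProgressive f u := by
  intro i
  refine Measurable.stronglyMeasurable ?_
  let _ : MeasurableSpace Ω := f i
  refine measurable_of_tendsto_metrizable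
    (f := fun k (p : Iic i × Ω) => u (min (gridAbove k p.1) i) p.2) (fun k => ?_) ?_
  · exact measurable_eval_countable_index
      (v := fun j (p : Iic i × Ω) => u (min (gridPoint k j) i) p.2)
      (fun j => ((hu (min (gridPoint k j) i)).mono (f.mono (min_le_right _ _)) le_rfl).comp
        measurable_snd)
      (N := fun p => gridIndex k p.1)
      ((measurable_gridIndex k).comp (measurable_subtype_coe.comp measurable_fst))
  · rw [tendsto_pi_nhds]
    rintro ⟨⟨s, hs⟩, ω⟩
    refine (hc ω s).tendsto.comp (tendsto_nhdsWithin_iff.2 ⟨?_, .of_forall fun k => ?_⟩)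
    · have := (tendsto_gridAbove s).min (tendsto_const_nhds (x := i))
      rwa [min_eq_left (show s ≤ i from hs)] at this
    · exact le_min (lt_gridAbove k s).le hs

end GridApproximation

/-! ### Disintegration of `P^μ` and the strong Markov property. -/

namespace BorelMarkovProcess

variable {E Ω : Type*} [TopologicalSpace E] [MeasurableSpace E] [mΩ : MeasurableSpace Ω]
  (X : BorelMarkovProcess E Ω) (μ : Measure (WithCemetery E)) [IsFiniteMeasure μ]

instance isFiniteMeasure_law : IsFiniteMeasure (X.law μ) := by
  constructor
  rw [X.law_apply μ MeasurableSet.univ]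
  have := X.isProbabilityMeasure
  simp

/-- The map `x ↦ P^x(A)` is only universally measurable, so a.e. measurability is carried through
the induction together with the integral formula. -/
theorem lintegral_law {F : Ω → ℝ≥0∞} (hF : Measurable F) :
    AEMeasurable (fun x => ∫⁻ ω, F ω ∂(X.P x)) μ ∧
      ∫⁻ ω, F ω ∂(X.law μ) = ∫⁻ x, ∫⁻ ω, F ω ∂(X.P x) ∂μ := by
  refine Measurable.ennreal_induction (motive := fun F : Ω → ℝ≥0∞ =>
    AEMeasurable (fun x => ∫⁻ ω, F ω ∂(X.P x)) μ ∧
      ∫⁻ ω, F ω ∂(X.law μ) = ∫⁻ x, ∫⁻ ω, F ω ∂(X.P x) ∂μ) ?_ ?_ ?_ hF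
  · intro c s hs
    simp only [lintegral_indicator_const hs]
    have h := X.universallyMeasurable s hs μ inferInstance
    refine ⟨h.const_mul c, ?_⟩
    rw [lintegral_const_mul'' _ h, X.law_apply μ hs]
  · intro f g _ hf hg ihf ihg
    simp only [Pi.add_apply, lintegral_add_left hf]
    refine ⟨ihf.1.add ihg.1, ?_⟩
    rw [lintegral_add_left' ihf.1, ihf.2, ihg.2]
  · intro f hf hmono ih
    simp only [lintegral_iSup hf hmono]
    refine ⟨AEMeasurable.iSup fun n => (ih n).1, ?_⟩
    rw [lintegral_iSup' (fun n => (ih n).1) (.of_forall fun x i j hij =>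
      lintegral_mono (hmono hij))]
    simp only [fun n => (ih n).2]

theorem measurable_X (t : ℝ≥0) : Measurable (X.X t) :=
  (X.adapted t).mono (X.ℱ.le t) le_rfl

/-- The transition kernels of the process on the state space with cemetery. -/
noncomputable def transitionKernel (t : ℝ≥0) :
    ProbabilityTheory.Kernel (WithCemetery E) (WithCemetery E) where
  toFun x := (X.P x).map (X.X t)
  measurable' := by
    refine Measure.measurable_of_measurable_coe _ fun A hA => ?_
    simpa only [Measure.map_apply (X.measurable_X t) hA] using X.borel_transition t A hA

theorem transitionKernel_apply (t : ℝ≥0) (x : WithCemetery E) :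
    X.transitionKernel t x = (X.P x).map (X.X t) := rfl

instance (t : ℝ≥0) : ProbabilityTheory.IsMarkovKernel (X.transitionKernel t) := by
  constructor
  intro x
  have := X.isProbabilityMeasure x
  exact Measure.isProbabilityMeasure_map (X.measurable_X t).aemeasurable

theorem integral_transitionKernel (t : ℝ≥0) {f : E → ℝ} (hf : Measurable f) (z : WithCemetery E) :
    ∫ y, extendZero f y ∂(X.transitionKernel t z) = extendZero (X.transition t f) z := by
  rw [transitionKernel_apply,
    integral_map (X.measurable_X t).aemeasurable (measurable_extendZero hf).aestronglyMeasurable]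
  rcases z with x | ⟨⟩
  · rfl
  · rw [extendZero_inr]
    refine integral_eq_zero_of_ae ?_
    filter_upwards [X.normal cemetery] with ω hω
    rw [X.absorbing ω 0 t zero_le hω]
    rfl

theorem law_inter_preimage (s t : ℝ≥0) {B : Set Ω} (hB : MeasurableSet[X.ℱ s] B)
    {A : Set (WithCemetery E)} (hA : MeasurableSet A) :
    X.law μ (B ∩ X.X (s + t) ⁻¹' A) =
      ∫⁻ ω in B, X.transitionKernel t (X.X s ω) A ∂(X.law μ) := by
  have hB' : MeasurableSet B := X.ℱ.le s _ hB
  have hm : Measurable fun ω => X.transitionKernel t (X.X s ω) A :=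
    ((X.transitionKernel t).measurable_coe hA).comp (X.measurable_X s)
  rw [X.law_apply μ (hB'.inter (X.measurable_X _ hA)), ← lintegral_indicator hB',
    (X.lintegral_law μ (hm.indicator hB')).2]
  refine lintegral_congr fun x => ?_
  rw [lintegral_indicator hB', X.markov x t s B hB A hA]
  refine lintegral_congr fun ω => ?_
  rw [transitionKernel_apply, Measure.map_apply (X.measurable_X t) hA]

theorem measurable_X_gridAbove_add {r : Ω → ℝ≥0} (hr : Measurable r) (k : ℕ) (t : ℝ≥0) :
    Measurable fun ω => X.X (gridAbove k (r ω) + t) ω :=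
  measurable_eval_countable_index (v := fun j => X.X (gridPoint k j + t))
    (fun _ => X.measurable_X _) ((measurable_gridIndex k).comp hr)

variable {τ : Ω → WithTop ℝ≥0}

/-- The time `gridAbove` takes countably many values, so the simple Markov property applies on each
piece `{N = j}` and the results are summed. -/
theorem law_inter_preimage_gridAbove (hτ : IsStoppingTime X.ℱ τ) (hfin : ∀ ω, τ ω ≠ ⊤)
    (k : ℕ) (t : ℝ≥0) {B : Set Ω} (hB : MeasurableSet[hτ.measurableSpace] B)
    {A : Set (WithCemetery E)} (hA : MeasurableSet A) :
    X.law μ (B ∩ {ω | X.X (gridAbove k (τ ω).untopA + t) ω ∈ A}) =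
      ∫⁻ ω in B, X.transitionKernel t (X.X (gridAbove k (τ ω).untopA) ω) A ∂(X.law μ) := by
  have hB' : MeasurableSet B := hτ.measurableSpace_le _ hB
  have hr : Measurable fun ω => (τ ω).untopA := hτ.measurable'.untopA
  set N : Ω → ℕ := fun ω => gridIndex k (τ ω).untopA with hN
  set q : ℕ → ℝ≥0 := gridPoint k with hq
  have hgrid : ∀ ω, gridAbove k (τ ω).untopA = q (N ω) := fun ω => rfl
  -- The cell is `{j/(k+1) ≤ τ < q j}`; since the grid point lies strictly above `τ`, this event is
  -- already known at time `q j`.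
  have hpart : ∀ j, MeasurableSet[X.ℱ (q j)] (B ∩ {ω | N ω = j}) := by
    intro j
    have h1 : B ∩ {ω | N ω = j} =
        (B ∩ {ω | τ ω ≤ q j}) ∩
          ({ω | τ ω < q j} \ {ω | τ ω < ((j : ℝ≥0) / ((k : ℝ≥0) + 1) : ℝ≥0)}) := by
      ext ω
      have hk : (0 : ℝ≥0) < (k : ℝ≥0) + 1 := by positivity
      have h2 : N ω = j ↔ (j : ℝ≥0) / ((k : ℝ≥0) + 1) ≤ (τ ω).untopA ∧ (τ ω).untopA < q j := by
        rw [hN, hq]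
        simp only
        rw [gridPoint, gridIndex, Nat.floor_eq_iff zero_le, div_le_iff₀ hk, lt_div_iff₀ hk, mul_comm]
      obtain ⟨r, h3⟩ := WithTop.ne_top_iff_exists.1 (hfin ω)
      rw [← h3, show WithTop.untopA (r : WithTop ℝ≥0) = r from rfl] at h2
      simp only [mem_inter_iff, mem_ofPred_eq, Set.mem_sdiff, h2, ← h3, WithTop.coe_lt_coe,
        WithTop.coe_le_coe, not_lt]
      constructor
      · rintro ⟨a, b, c⟩
        exact ⟨⟨a, c.le⟩, c, b⟩
      · rintro ⟨⟨a, _⟩, c, b⟩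
        exact ⟨a, b, c⟩
    rw [h1]
    refine (hB.2 _).inter
      ((hτ.measurableSet_lt _).diff (hτ.measurableSet_lt_le ?_))
    rw [hq, gridPoint]
    gcongr
    simp
  have hdisj : Pairwise (Function.onFun Disjoint fun j => B ∩ {ω | N ω = j}) := by
    intro i j hij
    refine Set.disjoint_left.2 ?_
    rintro ω ⟨_, h1⟩ ⟨_, h2⟩
    exact hij (h1.symm.trans h2)
  have hUnion : B = ⋃ j, B ∩ {ω | N ω = j} := by
    ext ω; simp
  have hmeas : ∀ j, MeasurableSet (B ∩ {ω | N ω = j}) := fun j => X.ℱ.le _ _ (hpart j)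
  have hAset : MeasurableSet {ω | X.X (gridAbove k (τ ω).untopA + t) ω ∈ A} :=
    X.measurable_X_gridAbove_add hr k t hA
  conv_lhs => rw [hUnion, iUnion_inter]
  conv_rhs => rw [hUnion]
  rw [lintegral_iUnion hmeas hdisj, measure_iUnion
    (fun i j hij => (hdisj hij).mono inter_subset_left inter_subset_left)
    (fun j => (hmeas j).inter hAset)]
  refine tsum_congr fun j => ?_
  have h1 : B ∩ {ω | N ω = j} ∩ {ω | X.X (gridAbove k (τ ω).untopA + t) ω ∈ A} =
      (B ∩ {ω | N ω = j}) ∩ X.X (q j + t) ⁻¹' A := by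
    ext ω
    simp only [mem_inter_iff, mem_ofPred_eq, mem_preimage, hgrid]
    constructor <;> rintro ⟨⟨a, b⟩, c⟩ <;> exact ⟨⟨a, b⟩, by simpa [b] using c⟩
  rw [h1, X.law_inter_preimage μ (q j) t (hpart j) hA]
  refine setLIntegral_congr_fun (hmeas j) ?_
  rintro ω ⟨_, b⟩
  simp only [hgrid, show N ω = j from b]

theorem setIntegral_gridAbove (hτ : IsStoppingTime X.ℱ τ) (hfin : ∀ ω, τ ω ≠ ⊤)
    (k : ℕ) (t : ℝ≥0) {B : Set Ω} (hB : MeasurableSet[hτ.measurableSpace] B)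
    {f : E → ℝ} (hf : Measurable f) {C : ℝ} (hC0 : 0 ≤ C) (hC : ∀ x, |f x| ≤ C) :
    ∫ ω in B, extendZero f (X.X (gridAbove k (τ ω).untopA + t) ω) ∂(X.law μ) =
      ∫ ω in B, extendZero (X.transition t f) (X.X (gridAbove k (τ ω).untopA) ω) ∂(X.law μ) := by
  have hB' : MeasurableSet B := hτ.measurableSpace_le _ hB
  have hr : Measurable fun ω => (τ ω).untopA := hτ.measurable'.untopA
  have hm1 := X.measurable_X_gridAbove_add hr k t
  have hm0 : Measurable fun ω => X.X (gridAbove k (τ ω).untopA) ω := by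
    simpa using X.measurable_X_gridAbove_add hr k 0
  -- The identity for sets says that the later law is the earlier one pushed through the transition
  -- kernel; bounded functions can then be integrated against it.
  have hmap : ((X.law μ).restrict B).map (fun ω => X.X (gridAbove k (τ ω).untopA + t) ω) =
      (((X.law μ).restrict B).map (fun ω => X.X (gridAbove k (τ ω).untopA) ω)).bind
        (X.transitionKernel t) := by
    ext A hA
    rw [Measure.map_apply hm1 hA, Measure.restrict_apply (hm1 hA), inter_comm,
      Measure.bind_apply hA (ProbabilityTheory.Kernel.aemeasurable _),
      lintegral_map ((X.transitionKernel t).measurable_coe hA) hm0]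
    exact X.law_inter_preimage_gridAbove μ hτ hfin k t hB hA
  have hfm := measurable_extendZero hf
  have hint : ∀ (m : Measure (WithCemetery E)) [IsFiniteMeasure m],
      Integrable (extendZero f) m := fun m _ =>
    .of_bound hfm.aestronglyMeasurable C (.of_forall (abs_extendZero_le hC0 hC))
  rw [← integral_map (μ := (X.law μ).restrict B) hm1.aemeasurable hfm.aestronglyMeasurable, hmap]
  have h := ProbabilityTheory.Kernel.integral_comp (η := X.transitionKernel t)
    (κ := ProbabilityTheory.Kernel.const Unit
      (((X.law μ).restrict B).map (fun ω => X.X (gridAbove k (τ ω).untopA) ω))) (a := ())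
    (f := extendZero f) (hint _)
  rw [ProbabilityTheory.Kernel.comp_apply, ProbabilityTheory.Kernel.const_apply] at h
  rw [h, integral_map hm0.aemeasurable]
  · simp only [X.integral_transitionKernel t hf]
  · exact hfm.stronglyMeasurable.integral_kernel.aestronglyMeasurable

theorem tendsto_extendZero_gridAbove {f : E → ℝ} (hf : Continuous f) (r t : ℝ≥0) (ω : Ω) :
    Tendsto (fun k => extendZero f (X.X (gridAbove k r + t) ω)) atTop
      (𝓝 (extendZero f (X.X (r + t) ω))) := by
  refine ((continuous_extendZero hf).tendsto _).comp
    ((X.rightContinuous ω (r + t)).tendsto.comp (tendsto_nhdsWithin_iff.2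
      ⟨(tendsto_gridAbove r).add_const t, .of_forall fun k => ?_⟩))
  exact add_le_add_left (lt_gridAbove k r).le t

/-- Right continuity gives this as a pointwise limit of evaluations at countably many times.
Composing with `f` first makes the limit real-valued. -/
theorem measurable_extendZero_X_add [BorelSpace E] {f : E → ℝ} (hf : Continuous f)
    {r : Ω → ℝ≥0} (hr : Measurable r) (t : ℝ≥0) :
    Measurable fun ω => extendZero f (X.X (r ω + t) ω) :=
  measurable_of_tendsto_metrizable
    (fun k => (measurable_extendZero hf.measurable).comp (X.measurable_X_gridAbove_add hr k t))
    (tendsto_pi_nhds.2 fun ω => X.tendsto_extendZero_gridAbove hf (r ω) t ω)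

theorem abs_transition_le {f : E → ℝ} {C : ℝ} (hC0 : 0 ≤ C) (hC : ∀ x, |f x| ≤ C)
    (t : ℝ≥0) (x : E) : |X.transition t f x| ≤ C := by
  have := X.isProbabilityMeasure (Sum.inl x)
  have h := norm_integral_le_of_norm_le_const (μ := X.P (Sum.inl x))
    (f := fun ω => extendZero f (X.X t ω)) (C := C)
    (.of_forall fun ω => abs_extendZero_le hC0 hC _)
  simpa [transition] using h

/-- The strong Markov property at a finite stopping time. -/
theorem condExp_extendZero_X_add [BorelSpace E] (hτ : IsStoppingTime X.ℱ τ)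
    (hfin : ∀ ω, τ ω ≠ ⊤) (t : ℝ≥0) {f : E → ℝ} (hf : Continuous f) {C : ℝ} (hC0 : 0 ≤ C)
    (hC : ∀ x, |f x| ≤ C) (hft : Continuous (X.transition t f)) :
    (X.law μ)[fun ω => extendZero f (X.X ((τ ω).untopA + t) ω) | hτ.measurableSpace] =ᵐ[X.law μ]
      fun ω => extendZero (X.transition t f) (X.X (τ ω).untopA ω) := by
  have hr : Measurable fun ω => (τ ω).untopA := hτ.measurable'.untopA
  have hm1 := X.measurable_extendZero_X_add hf hr t
  have hm2 : Measurable[hτ.measurableSpace] fun ω =>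
      extendZero (X.transition t f) (X.X (τ ω).untopA ω) := by
    refine measurable_stoppedValue (u := fun s ω => extendZero (X.transition t f) (X.X s ω))
      (isStronglyProgressive_of_rightContinuous (fun s => ?_) fun ω s => ?_) hτ
    · exact (measurable_extendZero hft.measurable).comp (X.adapted s)
    · exact (continuous_extendZero hft).continuousAt.comp_continuousWithinAt
        (X.rightContinuous ω s)
  have hm2' := hm2.mono hτ.measurableSpace_le le_rfl
  have hbd := X.abs_transition_le hC0 hC t
  have hi : Integrable (fun ω => extendZero (X.transition t f) (X.X (τ ω).untopA ω))
      (X.law μ) :=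
    .of_bound hm2'.aestronglyMeasurable C (.of_forall fun ω => abs_extendZero_le hC0 hbd _)
  symm
  refine ae_eq_condExp_of_forall_setIntegral_eq hτ.measurableSpace_le
    (.of_bound hm1.aestronglyMeasurable C (.of_forall fun ω => abs_extendZero_le hC0 hC _))
    (fun s _ _ => hi.integrableOn) (fun B hB _ => ?_) hm2.stronglyMeasurable.aestronglyMeasurable
  -- Let the grid shrink in the grid Markov identity: right continuity of paths with continuity of
  -- `f` handles one side, with continuity of `p_t f` the other.
  have hlim1 : Tendsto (fun k => ∫ ω in B,
      extendZero f (X.X (gridAbove k (τ ω).untopA + t) ω) ∂(X.law μ)) atTop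
      (𝓝 (∫ ω in B, extendZero f (X.X ((τ ω).untopA + t) ω) ∂(X.law μ))) :=
    tendsto_integral_of_dominated_convergence (fun _ => C)
      (fun k => ((measurable_extendZero hf.measurable).comp
        (X.measurable_X_gridAbove_add hr k t)).aestronglyMeasurable)
      (integrable_const _) (fun k => .of_forall fun ω => abs_extendZero_le hC0 hC _)
      (.of_forall fun ω => X.tendsto_extendZero_gridAbove hf _ t ω)
  have hlim2 : Tendsto (fun k => ∫ ω in B,
      extendZero (X.transition t f) (X.X (gridAbove k (τ ω).untopA) ω) ∂(X.law μ)) atTop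
      (𝓝 (∫ ω in B, extendZero (X.transition t f) (X.X (τ ω).untopA ω) ∂(X.law μ))) :=
    tendsto_integral_of_dominated_convergence (fun _ => C)
      (fun k => ((measurable_extendZero hft.measurable).comp
        (by simpa using X.measurable_X_gridAbove_add hr k 0)).aestronglyMeasurable)
      (integrable_const _) (fun k => .of_forall fun ω => abs_extendZero_le hC0 hbd _)
      (.of_forall fun ω => by simpa using X.tendsto_extendZero_gridAbove hft _ 0 ω)
  simp only [X.setIntegral_gridAbove μ hτ hfin _ t hB hf.measurable hC0 hC] at hlim1
  exact tendsto_nhds_unique hlim2 hlim1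

theorem tendsto_transition_zero [BorelSpace E] {f : E → ℝ} (hf : Continuous f) {C : ℝ}
    (hC0 : 0 ≤ C) (hC : ∀ x, |f x| ≤ C) {t : ℕ → ℝ≥0} (ht : Tendsto t atTop (𝓝 0)) (x : E) :
    Tendsto (fun k => X.transition (t k) f x) atTop (𝓝 (f x)) := by
  have := X.isProbabilityMeasure (Sum.inl x)
  have h : Tendsto (fun k => ∫ ω, extendZero f (X.X (t k) ω) ∂(X.P (Sum.inl x))) atTop
      (𝓝 (∫ _, f x ∂(X.P (Sum.inl x)))) := by
    refine tendsto_integral_of_dominated_convergence (fun _ => C)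
      (fun k => ((measurable_extendZero hf.measurable).comp
        (X.measurable_X _)).aestronglyMeasurable)
      (integrable_const _) (fun k => .of_forall fun ω => abs_extendZero_le hC0 hC _) ?_
    filter_upwards [X.normal (Sum.inl x)] with ω hω
    have h1 := ((continuous_extendZero hf).tendsto (X.X 0 ω)).comp
      ((X.rightContinuous ω 0).tendsto.comp
        (tendsto_nhdsWithin_iff.2 ⟨ht, .of_forall fun k => mem_Ici.2 zero_le⟩))
    rw [hω] at h1
    exact h1
  simpa [transition] using h

end BorelMarkovProcess

/-! ### Countable separating subfamilies. -/

/-- The open sets `{f x ≠ f y}` cover the complement of the diagonal of `E × E`, and by second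
countability countably many have the same union. Countability allows one null set to serve the whole
family. -/
theorem exists_countable_subset_separatesPoints {E : Type*} [TopologicalSpace E]
    [SecondCountableTopology E] {K : Set (E → ℝ)} (hc : ∀ f ∈ K, Continuous f)
    (hs : K.SeparatesPoints) : ∃ K₀ ⊆ K, K₀.Countable ∧ K₀.SeparatesPoints := by
  obtain ⟨K₀, hsub, hcount, hU⟩ := TopologicalSpace.isOpen_biUnion_countable K
    (fun f => {p : E × E | f p.1 ≠ f p.2}) fun f hf =>
      isOpen_ne_fun ((hc f hf).comp continuous_fst) ((hc f hf).comp continuous_snd)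
  refine ⟨K₀, hsub, hcount, fun x y hxy => ?_⟩
  obtain ⟨f, hf, hne⟩ := hs hxy
  have h : (x, y) ∈ ⋃ f ∈ K, {p : E × E | f p.1 ≠ f p.2} := mem_iUnion₂.2 ⟨f, hf, hne⟩
  rw [← hU] at h
  obtain ⟨g, hg, hg'⟩ := mem_iUnion₂.1 h
  exact ⟨g, hg, hg'⟩

theorem IsLusinSpace.secondCountableTopology {E : Type*} [TopologicalSpace E]
    (hE : IsLusinSpace E) : SecondCountableTopology E := by
  obtain ⟨K, _, _, B, _, ⟨e⟩⟩ := hE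
  exact e.secondCountableTopology

/-! ### Identification of the left limit and quasi-left continuity. -/

namespace BorelMarkovProcess

variable {E Ω : Type*} [TopologicalSpace E] [MeasurableSpace E] [mΩ : MeasurableSpace Ω]
  (X : BorelMarkovProcess E Ω)

theorem X_ne_cemetery_of_lt_lifetime {ω : Ω} {t : ℝ≥0} (h : (t : WithTop ℝ≥0) < X.lifetime ω) :
    X.X t ω ≠ cemetery := fun h0 =>
  (sInf_le (mem_image_of_mem _ h0) : X.lifetime ω ≤ t).not_gt h

/-- Along the stopping times of a sequence increasing to a finite time `s`, the conditional
expectation of `f(X_s)` is the value of `f` at the limit of the process, where that exists. -/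
theorem ae_eq_condExp_of_tendsto [BorelSpace E] (μ : Measure (WithCemetery E)) [IsFiniteMeasure μ]
    {σ : ℕ → Ω → WithTop ℝ≥0} (hσ : ∀ n, IsStoppingTime X.ℱ (σ n)) (hfin : ∀ n ω, σ n ω ≠ ⊤)
    (𝒢 : Filtration ℕ mΩ) (h𝒢 : ∀ n, 𝒢 n = (hσ n).measurableSpace)
    {s : Ω → ℝ≥0} (hs : Measurable s) (hle : ∀ n ω, (σ n ω).untopA ≤ s ω)
    (hlim : ∀ ω, Tendsto (fun n => (σ n ω).untopA) atTop (𝓝 (s ω)))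
    {f : E → ℝ} (hf : Continuous f) {C : ℝ} (hC : ∀ x, |f x| ≤ C)
    (hft : ∀ t : ℝ≥0, 0 < t → Continuous (X.transition t f)) :
    ∀ᵐ ω ∂(X.law μ), ∀ y : E,
      Tendsto (fun n => X.X (σ n ω).untopA ω) atTop (𝓝 (Sum.inl y)) →
      f y = ((X.law μ)[fun ω => extendZero f (X.X (s ω) ω) | ⨆ n, 𝒢 n]) ω := by
  -- If `E` is empty the bound does not force `0 ≤ C`, yet `C` must also dominate the value `0` at
  -- the cemetery.
  wlog hC0 : 0 ≤ C generalizing C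
  · exact this (C := |C|) (fun x => (hC x).trans (le_abs_self C)) (abs_nonneg C)
  set t : ℕ → ℝ≥0 := fun k => 1 / ((k : ℝ≥0) + 1) with ht
  have ht0 : ∀ k, 0 < t k := fun k => by positivity
  have htlim : Tendsto t atTop (𝓝 0) := tendsto_one_div_add_atTop_nhds_zero_nat
  have hr : ∀ n, Measurable fun ω => (σ n ω).untopA := fun n => (hσ n).measurable'.untopA
  have hYm : Measurable fun ω => extendZero f (X.X (s ω) ω) := by
    simpa using X.measurable_extendZero_X_add hf hs 0
  have key := ae_eq_condExp_iSup_of_iterated_tendsto (P := X.law μ) 𝒢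
    (Y := fun ω => extendZero f (X.X (s ω) ω))
    (Z := fun k n ω => extendZero f (X.X ((σ n ω).untopA + t k) ω)) (C := C) hYm
    (fun ω => abs_extendZero_le hC0 hC _)
    (fun k n => X.measurable_extendZero_X_add hf (hr n) (t k))
    (fun k n ω => abs_extendZero_le hC0 hC _)
    (.of_forall fun ω ε hε => by
      have hcont : Tendsto (fun v => extendZero f (X.X v ω)) (𝓝[≥] (s ω))
          (𝓝 (extendZero f (X.X (s ω) ω))) :=
        ((continuous_extendZero hf).tendsto _).comp (X.rightContinuous ω (s ω)).tendsto
      have h1 := (Metric.tendsto_nhds.1 hcont ε hε)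
      obtain ⟨u, hu, hsub⟩ := mem_nhdsGE_iff_exists_Ico_subset.1 h1
      have h2 : ∀ᶠ k in atTop, s ω + t k < u :=
        (by simpa using htlim.const_add (s ω) : Tendsto (fun k => s ω + t k) atTop
          (𝓝 (s ω))).eventually_lt_const hu
      filter_upwards [h2] with k hk
      -- For fixed `t k > 0`, the time `σ n + t k` eventually exceeds `s`; this is why `n` goes to
      -- infinity before `k`, and why right continuity at `s` suffices.
      have h3 : ∀ᶠ n in atTop, s ω < (σ n ω).untopA + t k :=
        ((hlim ω).add_const (t k)).eventually_const_lt (lt_add_of_pos_right _ (ht0 k))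
      filter_upwards [h3] with n hn
      have h4 := hsub ⟨hn.le, (add_le_add_left (hle n ω) (t k)).trans_lt hk⟩
      exact (Real.dist_eq _ _ ▸ h4 : |_ - _| < ε).le)
  have hcond : ∀ᵐ ω ∂(X.law μ), ∀ k n,
      ((X.law μ)[fun ω => extendZero f (X.X ((σ n ω).untopA + t k) ω) | 𝒢 n]) ω =
        extendZero (X.transition (t k) f) (X.X (σ n ω).untopA ω) := by
    refine ae_all_iff.2 fun k => ae_all_iff.2 fun n => ?_
    rw [h𝒢 n]
    exact X.condExp_extendZero_X_add μ (hσ n) (hfin n) (t k) hf hC0 hC (hft _ (ht0 k))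
  filter_upwards [key, hcond] with ω h1 h2 y hy
  refine h1 (fun k => X.transition (t k) f y) (f y) (fun k => ?_)
    (X.tendsto_transition_zero hf hC0 hC htlim y)
  simp only [h2 k]
  exact ((continuous_extendZero (hft _ (ht0 k))).tendsto (Sum.inl y)).comp hy

/-- Applied to `f` and to `f * f`, the previous result yields `E[Y² | 𝒢] = f(y)² = E[Y | 𝒢]²` for `Y
= f(X_s)`, so `Y` equals its conditional expectation at such `ω`. -/
theorem ae_extendZero_eq_of_tendsto [BorelSpace E] (μ : Measure (WithCemetery E))
    [IsFiniteMeasure μ] {σ : ℕ → Ω → WithTop ℝ≥0} (hσ : ∀ n, IsStoppingTime X.ℱ (σ n))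
    (hfin : ∀ n ω, σ n ω ≠ ⊤) (hmono : ∀ ω, Monotone fun n => σ n ω)
    {s : Ω → ℝ≥0} (hle : ∀ n ω, (σ n ω).untopA ≤ s ω)
    (hlim : ∀ ω, Tendsto (fun n => (σ n ω).untopA) atTop (𝓝 (s ω)))
    {f : E → ℝ} (hf : Continuous f) {C : ℝ} (hC : ∀ x, |f x| ≤ C)
    (hft : ∀ t : ℝ≥0, 0 < t → Continuous (X.transition t f))
    (hft2 : ∀ t : ℝ≥0, 0 < t → Continuous (X.transition t (f * f))) :
    ∀ᵐ ω ∂(X.law μ), ∀ y : E,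
      Tendsto (fun n => X.X (σ n ω).untopA ω) atTop (𝓝 (Sum.inl y)) →
      extendZero f (X.X (s ω) ω) = f y := by
  let 𝒢 : Filtration ℕ mΩ :=
    { seq := fun n => (hσ n).measurableSpace
      mono' := fun i j hij => (hσ i).measurableSpace_mono (hσ j) fun ω => hmono ω hij
      le' := fun n => (hσ n).measurableSpace_le }
  have hs : Measurable s := measurable_of_tendsto_metrizable
    (fun n => (hσ n).measurable'.untopA) (tendsto_pi_nhds.2 hlim)
  have hYm : Measurable fun ω => extendZero f (X.X (s ω) ω) := by
    simpa using X.measurable_extendZero_X_add hf hs 0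
  have hC0 : ∀ x, |f x| ≤ |C| := fun x => (hC x).trans (le_abs_self C)
  have hCC : ∀ x, |(f * f) x| ≤ |C| * |C| := fun x => by
    rw [Pi.mul_apply, abs_mul]
    exact mul_le_mul (hC0 x) (hC0 x) (abs_nonneg _) (abs_nonneg _)
  have hY2 : (fun ω => extendZero f (X.X (s ω) ω)) ^ 2 =
      fun ω => extendZero (f * f) (X.X (s ω) ω) := by
    ext ω
    rw [extendZero_mul, Pi.pow_apply, sq]
  have hL2 : MemLp (fun ω => extendZero f (X.X (s ω) ω)) 2 (X.law μ) :=
    .of_bound hYm.aestronglyMeasurable |C|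
      (.of_forall fun ω => abs_extendZero_le (abs_nonneg C) hC0 _)
  filter_upwards [X.ae_eq_condExp_of_tendsto μ hσ hfin 𝒢 (fun _ => rfl) hs hle hlim hf hC hft,
    X.ae_eq_condExp_of_tendsto μ hσ hfin 𝒢 (fun _ => rfl) hs hle hlim (hf.mul hf) hCC hft2,
    ae_eq_condExp_of_condExp_sq_eq (iSup_le 𝒢.le) hL2] with ω h1 h2 h3 y hy
  rw [hY2] at h3
  rw [h3 (by rw [← h1 y hy, ← show (f * f) y = _ from h2 y hy, Pi.mul_apply, sq]), ← h1 y hy]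

theorem isQuasiLeftContinuous_of_continuous_transition [BorelSpace E] [SecondCountableTopology E]
    (hcad : X.HasCadlagPaths) {K : Set (E → ℝ)} (hKc : ∀ f ∈ K, Continuous f)
    (hKb : ∀ f ∈ K, ∃ C : ℝ, ∀ x, |f x| ≤ C) (hKm : IsMultiplicative K)
    (hKs : K.SeparatesPoints)
    (hKt : ∀ f ∈ K, ∀ t : ℝ≥0, 0 < t → Continuous (X.transition t f)) :
    X.IsQuasiLeftContinuous := by
  intro μ hμ τ T hτ hmono hT
  obtain ⟨K₀, hsub, hcount, hsep⟩ := exists_countable_subset_separatesPoints hKc hKs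
  have hle : ∀ n ω, τ n ω ≤ T ω := fun n ω => hT ω ▸ le_iSup (fun n => τ n ω) n
  have hfin : ∀ (N : ℕ) (z : WithTop ℝ≥0), min z ((N : ℝ≥0) : WithTop ℝ≥0) ≠ ⊤ := fun N z =>
    ((min_le_right _ _).trans_lt (WithTop.coe_lt_top _)).ne
  -- Truncation at each integer `N` makes all times finite; the null sets for all `N` and all `f ∈
  -- K₀` are then merged.
  have hkey : ∀ N : ℕ, ∀ f ∈ K₀, ∀ᵐ ω ∂(X.law (μ.map Sum.inl)), ∀ y : E,
      Tendsto (fun n => X.X (min (τ n ω) ((N : ℝ≥0) : WithTop ℝ≥0)).untopA ω) atTop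
        (𝓝 (Sum.inl y)) →
      extendZero f (X.X (min (T ω) ((N : ℝ≥0) : WithTop ℝ≥0)).untopA ω) = f y := by
    intro N f hf
    obtain ⟨C, hC⟩ := hKb f (hsub hf)
    have hle' : ∀ n ω, (min (τ n ω) ((N : ℝ≥0) : WithTop ℝ≥0)).untopA ≤
        (min (T ω) ((N : ℝ≥0) : WithTop ℝ≥0)).untopA := fun n ω =>
      WithTop.untopA_mono (hfin N _) (min_le_min_right _ (hle n ω))
    refine X.ae_extendZero_eq_of_tendsto (μ.map Sum.inl) (fun n => (hτ n).min_const (N : ℝ≥0))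
      (fun n ω => hfin N _) (fun ω i j hij => min_le_min_right _ (hmono ω hij)) hle' (fun ω => ?_)
      (hKc f (hsub hf)) hC (hKt f (hsub hf)) (hKt _ (hKm f (hsub hf) f (hsub hf)))
    refine tendsto_atTop_isLUB (fun i j hij => WithTop.untopA_mono (hfin N _)
      (min_le_min_right _ (hmono ω hij))) ⟨?_, fun b hb => ?_⟩
    · rintro _ ⟨n, rfl⟩
      exact hle' n ω
    · rw [WithTop.untopA_le_iff (hfin N _)]
      have hb' : ∀ n, min (τ n ω) ((N : ℝ≥0) : WithTop ℝ≥0) ≤ b := fun n =>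
        (WithTop.untopA_le_iff (hfin N _)).1 (hb (mem_range_self n))
      rcases le_or_gt ((N : ℝ≥0) : WithTop ℝ≥0) b with h | h
      · exact (min_le_right _ _).trans h
      · refine (min_le_left _ _).trans ?_
        rw [hT ω]
        exact iSup_le fun n => (min_le_iff.1 (hb' n)).resolve_right h.not_ge
  have hall := ae_all_iff.2 fun N => (ae_ball_iff hcount).2 (hkey N)
  filter_upwards [hcad μ hμ, hall] with ω hleft hω hlt
  obtain ⟨r, hr⟩ := WithTop.ne_top_iff_exists.1 (hlt.trans_le le_top).ne
  have hn : ∀ n, ∃ q : ℝ≥0, (q : WithTop ℝ≥0) = τ n ω ∧ q ≤ r := fun n => by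
    have h1 := hle n ω
    rw [← hr] at h1
    obtain ⟨q, hq⟩ := WithTop.ne_top_iff_exists.1 (h1.trans_lt (WithTop.coe_lt_top r)).ne
    exact ⟨q, hq, by rwa [← hq, WithTop.coe_le_coe] at h1⟩
  choose q hq hqr using hn
  have hqmono : Monotone q := fun i j hij => by
    have := hmono ω hij
    simpa only [← hq, WithTop.coe_le_coe] using this
  have hqlim : Tendsto q atTop (𝓝 r) := by
    refine tendsto_atTop_isLUB hqmono ⟨?_, fun b hb => ?_⟩
    · rintro _ ⟨n, rfl⟩
      exact hqr n
    · rw [← WithTop.coe_le_coe, hr, hT ω]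
      refine iSup_le fun n => ?_
      rw [← hq n]
      exact WithTop.coe_le_coe.2 (hb (mem_range_self n))
  have hXτ : ∀ n, stoppedValue X.X (τ n) ω = X.X (q n) ω := fun n => by
    rw [stoppedValue, ← hq n]; rfl
  have hXT : stoppedValue X.X T ω = X.X r ω := by
    rw [stoppedValue, ← hr]; rfl
  simp only [hXτ, hXT]
  rw [← hr] at hlt
  by_cases hex : ∃ n, q n = r
  -- If some `T_n` equals `T`, the sequence is eventually constant; the left limit at `T` is needed
  -- only when every `T_n` is strictly smaller.
  · obtain ⟨n₀, hn₀⟩ := hex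
    refine tendsto_const_nhds.congr' ?_
    filter_upwards [eventually_ge_atTop n₀] with n hge
    rw [le_antisymm (hqr n) (hn₀ ▸ hqmono hge)]
  · simp only [not_exists] at hex
    have hqlt : ∀ n, q n < r := fun n => lt_of_le_of_ne (hqr n) (hex n)
    obtain ⟨y, hy⟩ := hleft r (zero_le.trans_lt (hqlt 0)) hlt
    have hlimX : Tendsto (fun n => X.X (q n) ω) atTop (𝓝 (Sum.inl y)) :=
      hy.comp (tendsto_nhdsWithin_iff.2 ⟨hqlim, .of_forall hqlt⟩)
    -- For an integer `N ≥ T ω` the truncation leaves every time unchanged at this `ω`.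
    obtain ⟨N, hN⟩ := exists_nat_ge r
    have hmin : ∀ a : ℝ≥0, a ≤ r →
        (min (a : WithTop ℝ≥0) ((N : ℝ≥0) : WithTop ℝ≥0)).untopA = a := fun a ha => by
      rw [min_eq_left (WithTop.coe_le_coe.2 (ha.trans hN))]; rfl
    have hy' : ∀ f ∈ K₀, extendZero f (X.X r ω) = f y := fun f hf => by
      have := hω N f hf y
      simp only [← hq, ← hr, hmin r le_rfl, hmin _ (hqr _)] at this
      exact this hlimX
    -- The family need not separate `y` from the cemetery, as all its members may vanish at `y`; the
    -- condition `T < ζ` rules that case out.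
    have hne := X.X_ne_cemetery_of_lt_lifetime hlt
    rcases hx : X.X r ω with x | ⟨⟩
    · have hxy : x = y := by
        by_contra hxy
        obtain ⟨f, hf, hfne⟩ := hsep hxy
        have := hy' f hf
        rw [hx] at this
        exact hfne this
      rw [hxy]
      exact hlimX
    · exact absurd hx hne

/-! ### Boundedness and continuity in sup-norm closures, and the conclusion. -/

theorem exists_bound_of_mem_boundedExcessiveSpan {β : ℝ} {f : E → ℝ}
    (hf : f ∈ X.boundedExcessiveSpan β) : ∃ C : ℝ, ∀ x, |f x| ≤ C := by
  induction hf using Submodule.span_induction with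
  | mem f hf =>
    obtain ⟨h0, ⟨C, hC⟩, _⟩ := hf
    exact ⟨C, fun x => by rw [abs_of_nonneg (h0 x)]; exact hC x⟩
  | zero => exact ⟨0, fun x => by simp⟩
  | add f g _ _ hf hg =>
    obtain ⟨C, hC⟩ := hf
    obtain ⟨D, hD⟩ := hg
    exact ⟨C + D, fun x => (abs_add_le _ _).trans (add_le_add (hC x) (hD x))⟩
  | smul c f _ hf =>
    obtain ⟨C, hC⟩ := hf
    refine ⟨|c| * C, fun x => ?_⟩
    rw [Pi.smul_apply, smul_eq_mul, abs_mul]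
    exact mul_le_mul_of_nonneg_left (hC x) (abs_nonneg c)

end BorelMarkovProcess

theorem GeneratesTopology.continuous {E : Type*} [t : TopologicalSpace E] {F : Set (E → ℝ)}
    (hF : GeneratesTopology F) {f : E → ℝ} (hf : f ∈ F) : Continuous f := by
  rw [continuous_iff_le_induced]
  exact hF.le.trans (iInf₂_le f hf)

theorem continuous_of_mem_supNormClosure {E : Type*} [TopologicalSpace E] {G : Set (E → ℝ)}
    (hG : ∀ g ∈ G, Continuous g) {f : E → ℝ} (hf : f ∈ supNormClosure G) : Continuous f := by
  refine continuous_of_uniform_approx_of_continuous fun u hu => ?_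
  obtain ⟨ε, hε, hεu⟩ := Metric.mem_uniformity_dist.1 hu
  obtain ⟨g, hg, hfg⟩ := hf (ε / 2) (half_pos hε)
  refine ⟨g, hG g hg, fun x => hεu ?_⟩
  rw [Real.dist_eq]
  exact (hfg x).trans_lt (half_lt_self hε)

theorem exists_bound_of_mem_supNormClosure {E : Type*} {G : Set (E → ℝ)}
    (hG : ∀ g ∈ G, ∃ C : ℝ, ∀ x, |g x| ≤ C) {f : E → ℝ} (hf : f ∈ supNormClosure G) :
    ∃ C : ℝ, ∀ x, |f x| ≤ C := by
  obtain ⟨g, hg, hfg⟩ := hf 1 one_pos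
  obtain ⟨C, hC⟩ := hG g hg
  refine ⟨1 + C, fun x => ?_⟩
  calc |f x| = |(f x - g x) + g x| := by rw [sub_add_cancel]
    _ ≤ |f x - g x| + |g x| := abs_add_le _ _
    _ ≤ 1 + C := add_le_add (hfg x) (hC x)

theorem continuous_of_mem_span {E : Type*} [TopologicalSpace E] {F : Set (E → ℝ)}
    (hF : ∀ f ∈ F, Continuous f) {g : E → ℝ} (hg : g ∈ Submodule.span ℝ F) : Continuous g := by
  induction hg using Submodule.span_induction with
  | mem f hf => exact hF f hf
  | zero => exact continuous_const
  | add f g _ _ hf hg => exact hf.add hg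
  | smul c f _ hf => exact hf.const_smul c

theorem lemma2p3 {E Ω : Type*} [TopologicalSpace E] [MeasurableSpace E] [BorelSpace E]
    [MeasurableSpace Ω] (hE : IsLusinSpace E)
    (X : BorelMarkovProcess E Ω) (hX : X.IsRight) (hcad : X.HasCadlagPaths) :
    (∀ β : ℝ, 0 < β → ∀ F K : Set (E → ℝ),
      F.Countable → F ⊆ (X.boundedExcessiveSpan β : Set (E → ℝ)) → GeneratesTopology F →
      K ⊆ supNormClosure (Submodule.span ℝ F : Set (E → ℝ)) →
      IsMultiplicative K → K.SeparatesPoints →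
      (∀ f ∈ K, ∀ t : ℝ≥0, 0 < t →
        X.transition t f ∈ supNormClosure (Submodule.span ℝ F : Set (E → ℝ))) →
      X.IsQuasiLeftContinuous ∧ X.IsStandard) ∧
    (X.IsMarkovian → ∀ K : Set (E → ℝ),
      (∀ f ∈ K, Continuous f ∧ ∃ C : ℝ, ∀ x, |f x| ≤ C) →
      IsMultiplicative K → K.SeparatesPoints →
      (∀ f ∈ K, ∀ t : ℝ≥0, 0 < t → Continuous (X.transition t f)) →
      X.IsQuasiLeftContinuous ∧ X.IsStandard) := by
  -- The Lusin property enters through second countability, on which the countable separating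
  -- subfamily rests.
  have := hE.secondCountableTopology
  refine ⟨fun β _ F K _ hFβ hFt hKF hKm hKs hKt => ?_, fun _ K hK hKm hKs hKt => ?_⟩
  · have hcont : ∀ g ∈ supNormClosure (Submodule.span ℝ F : Set (E → ℝ)), Continuous g :=
      fun g hg => continuous_of_mem_supNormClosure
        (fun h hh => continuous_of_mem_span (fun f hf => hFt.continuous hf) hh) hg
    have hqlc := X.isQuasiLeftContinuous_of_continuous_transition hcad
      (fun f hf => hcont f (hKF hf))
      (fun f hf => exists_bound_of_mem_supNormClosure
        (fun g hg => X.exists_bound_of_mem_boundedExcessiveSpan (Submodule.span_le.2 hFβ hg))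
        (hKF hf)) hKm hKs (fun f hf t ht => hcont _ (hKt f hf t ht))
    exact ⟨hqlc, hX, hcad, hqlc⟩
  · have hqlc := X.isQuasiLeftContinuous_of_continuous_transition hcad
      (fun f hf => (hK f hf).1) (fun f hf => (hK f hf).2) hKm hKs hKt
    exact ⟨hqlc, hX, hcad, hqlc⟩
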